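/- There exists an absolute constant $c>0$ such that the following holds. Let $n\ge 1$ and $r\ge 0$ be integers, and let $M\in\{0,1\}^{n\times n}$ be a matrix whose rank over $\mathbb{R}$ is at most $r$ and whose density $p(M)=|M|/n^2$ is at most $1/2$, where $|M|$ denotes the number of entries of $M$ equal to $1$. Let $z(M)$ denote the largest integer $z\ge 0$ for which there exist a set $X\subseteq[n]$ of rows and a set $Y\subseteq[n]$ of columns with $|X|=|Y|=z$ such that $M_{i,j}=0$ for all $i\in X$ and $j\in Y$. Then $$z(M)\ \ge\ \frac{n}{2^{c\sqrt{r}}}.$$ -/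

import Mathlib

namespace LowRank

/-- `M` is a binary matrix, i.e. all its entries are `0` or `1`; it is regarded as a real matrix. -/
def IsBinary {m n : ℕ} (M : Matrix (Fin m) (Fin n) ℝ) : Prop :=
  ∀ i j, M i j = 0 ∨ M i j = 1

open Classical in
/-- `|M|`: the number of entries of `M` that are equal to `1`. -/
noncomputable def numOnes {m n : ℕ} (M : Matrix (Fin m) (Fin n) ℝ) : ℕ :=
  (Finset.univ.filter (fun e : Fin m × Fin n => M e.1 e.2 = 1)).card

/-- The density `p(M) = |M| / (m n)` of an `m × n` binary matrix `M`. -/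
noncomputable def density {m n : ℕ} (M : Matrix (Fin m) (Fin n) ℝ) : ℝ :=
  (numOnes M : ℝ) / ((m : ℝ) * (n : ℝ))

/-- The sizes `z` for which there are a set `X` of `z` rows and a set `Y` of `z` columns such that
the submatrix `M[X × Y]` has only `0` entries. -/
def zeroSizes {n : ℕ} (M : Matrix (Fin n) (Fin n) ℝ) : Set ℕ :=
  {z | ∃ X Y : Finset (Fin n), X.card = z ∧ Y.card = z ∧ ∀ i ∈ X, ∀ j ∈ Y, M i j = 0}

/-- `z(M)`: the largest `z` such that `M` has an all-`0` submatrix of size `z × z`. -/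
noncomputable def maxZeroSize {n : ℕ} (M : Matrix (Fin n) (Fin n) ℝ) : ℕ :=
  sSup (zeroSizes M)

/-- The supremum defining `z(M)` is a maximum. -/
theorem isGreatest_maxZeroSize {n : ℕ} (M : Matrix (Fin n) (Fin n) ℝ) :
    IsGreatest (zeroSizes M) (maxZeroSize M) := by
  have hne : (zeroSizes M).Nonempty := ⟨0, ∅, ∅, by simp⟩
  have hb : BddAbove (zeroSizes M) := by
    refine ⟨n, ?_⟩
    rintro z ⟨X, Y, hX, -, -⟩
    rw [← hX]
    simpa using X.card_le_univ
  exact ⟨Nat.sSup_mem hne hb, fun z hz => le_csSup hb hz⟩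

end LowRank

/-! The proof is a density decrement driven by Grothendieck's inequality. For `M` of size m × n and
density p, put N = M - p, a matrix of rank at most r + 1. If no rectangle has noticeably fewer ones
than expected, then no rectangle has many more either, because N sums to zero, so the bilinear form
of N is small on the product of two cubes. The dual form of Grothendieck's inequality
(`exists_dominating_weights`) then rescales rows and columns so that N becomes a contraction, whose
squared Frobenius norm is at most its rank (`sum_sq_div_le_rank`). But for p ≤ 1/2 every 1 of `M`
contributes at least 1/4 before rescaling, and at least half of the ones avoid the heavy rows and
columns. For p ≥ 1/(4r) this forces a rectangle of deficit of order mn√(p/r)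
(`exists_sparse_rectangle`).

Passing to such a rectangle lowers the density. The potential exp(-K√(rp)) pays for the loss of
size, so the total loss is exp(-O(√r)) (`exists_zero_rectangle`). Once p < 1/(4r), a spanning set of
at most r sparse rows already leaves half of the columns empty (`exists_zero_rectangle_of_sparse`).
-/

namespace LowRank

open Finset

/-! ### Rademacher sums -/

/-- The Rademacher sum `∑ k, ± b k` with the signs given by `s`. -/
def signSum {d : ℕ} (b : Fin d → ℝ) (s : Fin d → Bool) : ℝ :=
  ∑ k, (if s k then 1 else -1) * b k

theorem sum_bool_cons {d : ℕ} (F : (Fin (d + 1) → Bool) → ℝ) :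
    ∑ s, F s = ∑ s : Fin d → Bool,
      (F (Fin.cons true s : Fin (d + 1) → Bool) + F (Fin.cons false s : Fin (d + 1) → Bool)) := by
  rw [← Equiv.sum_comp (Fin.consEquiv fun _ : Fin (d + 1) => Bool) F, Fintype.sum_prod_type,
    Fintype.sum_bool, ← Finset.sum_add_distrib]
  rfl

theorem signSum_cons_true {d : ℕ} (b : Fin (d + 1) → ℝ) (s : Fin d → Bool) :
    signSum b (Fin.cons true s : Fin (d + 1) → Bool) = signSum (Fin.tail b) s + b 0 := by
  simp [signSum, Fin.sum_univ_succ, Fin.tail, add_comm]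

theorem signSum_cons_false {d : ℕ} (b : Fin (d + 1) → ℝ) (s : Fin d → Bool) :
    signSum b (Fin.cons false s : Fin (d + 1) → Bool) = signSum (Fin.tail b) s - b 0 := by
  simp [signSum, Fin.sum_univ_succ, Fin.tail]
  ring

theorem sum_signSum_mul {d : ℕ} (b c : Fin d → ℝ) :
    ∑ s, signSum b s * signSum c s = 2 ^ d * ∑ k, b k * c k := by
  induction d with
  | zero => simp [signSum]
  | succ d ih =>
    rw [sum_bool_cons]
    simp only [signSum_cons_true, signSum_cons_false]
    have h : ∀ s, (signSum (Fin.tail b) s + b 0) * (signSum (Fin.tail c) s + c 0) +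
        (signSum (Fin.tail b) s - b 0) * (signSum (Fin.tail c) s - c 0) =
        2 * (signSum (Fin.tail b) s * signSum (Fin.tail c) s) + 2 * (b 0 * c 0) := by
      intro s; ring
    simp only [h, sum_add_distrib, ← mul_sum, ih, Fin.sum_univ_succ, Fin.tail]
    simp
    ring

theorem sum_signSum_sq {d : ℕ} (b : Fin d → ℝ) :
    ∑ s, signSum b s ^ 2 = 2 ^ d * ∑ k, b k ^ 2 := by
  simpa [sq] using sum_signSum_mul b b

/-- Khintchine's fourth moment bound, by induction on one sign: odd powers cancel, and with constant
3 the mixed terms match exactly. It controls the tails cut off by truncation. -/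
theorem sum_signSum_pow_four_le {d : ℕ} (b : Fin d → ℝ) :
    ∑ s, signSum b s ^ 4 ≤ 3 * 2 ^ d * (∑ k, b k ^ 2) ^ 2 := by
  induction d with
  | zero => simp [signSum]
  | succ d ih =>
    rw [sum_bool_cons]
    simp only [signSum_cons_true, signSum_cons_false]
    have h : ∀ s, (signSum (Fin.tail b) s + b 0) ^ 4 + (signSum (Fin.tail b) s - b 0) ^ 4 =
        2 * signSum (Fin.tail b) s ^ 4 + 12 * b 0 ^ 2 * signSum (Fin.tail b) s ^ 2 +
          2 * b 0 ^ 4 := by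
      intro s; ring
    simp only [h, sum_add_distrib, ← mul_sum, sum_signSum_sq]
    have h1 := ih (Fin.tail b)
    have h2 : ∑ k, b k ^ 2 = b 0 ^ 2 + ∑ k, Fin.tail b k ^ 2 := by
      simp [Fin.sum_univ_succ, Fin.tail]
    rw [h2]
    set A := ∑ k, Fin.tail b k ^ 2
    have h3 : (0 : ℝ) ≤ 2 ^ d * b 0 ^ 4 := by positivity
    simp only [sum_const, card_univ, Fintype.card_fun, Fintype.card_bool, Fintype.card_fin,
      nsmul_eq_mul]
    push_cast
    rw [pow_succ (2 : ℝ) d]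
    nlinarith

/-! ### Truncation -/

/-- The truncation of `x` to the interval `[-7, 7]`. -/
noncomputable def trunc (x : ℝ) : ℝ := max (-7) (min x 7)

theorem abs_trunc_le (x : ℝ) : |trunc x| ≤ 7 := by
  unfold trunc
  rw [abs_le]
  exact ⟨le_max_left _ _, max_le (by norm_num) (min_le_right _ _)⟩

theorem trunc_sq_le (x : ℝ) : trunc x ^ 2 ≤ x ^ 2 := by
  unfold trunc
  rcases le_total x 7 with h | h <;> rcases le_total (-7) x with h' | h'
  · simp [h, h']
  · rw [min_eq_left h, max_eq_left h']; nlinarith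
  · rw [min_eq_right h]; norm_num; nlinarith
  · linarith

/-- The remainder vanishes for |x| ≤ 7; beyond that it is at most |x|, and x² ≥ 49. -/
theorem sub_trunc_sq_le (x : ℝ) : (x - trunc x) ^ 2 ≤ x ^ 4 / 49 := by
  unfold trunc
  rcases le_total x 7 with h | h <;> rcases le_total (-7) x with h' | h'
  · rw [min_eq_left h, max_eq_right h']; simp; positivity
  · rw [min_eq_left h, max_eq_left h']
    have : (x - -7) ^ 2 ≤ x ^ 2 := by nlinarith
    have h2 : 49 ≤ x ^ 2 := by nlinarith
    nlinarith
  · rw [min_eq_right h, max_eq_right (by norm_num)]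
    have : (x - 7) ^ 2 ≤ x ^ 2 := by nlinarith
    have h2 : 49 ≤ x ^ 2 := by nlinarith
    nlinarith
  · linarith

/-! ### Gram matrices and the factorization form of Grothendieck's inequality -/

/-- Positive semidefinite matrices with diagonal entries at most `1`. -/
def gramSet (τ : Type*) : Set (Matrix τ τ ℝ) :=
  {G | G.PosSemidef ∧ ∀ i, G i i ≤ 1}

section Gram

variable {τ : Type*} [Fintype τ]

theorem posSemidef_gram {Ω : Type*} [Fintype Ω] (f : τ → Ω → ℝ) :
    (Matrix.of fun i j => ∑ ω, f i ω * f j ω).PosSemidef := by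
  have h := Matrix.posSemidef_conjTranspose_mul_self (Matrix.of fun (ω : Ω) (i : τ) => f i ω)
  convert h using 1
  ext i j
  simp [Matrix.mul_apply]

open scoped MatrixOrder in
theorem exists_gram_of_posSemidef {G : Matrix τ τ ℝ} (hG : G.PosSemidef) :
    ∃ (d : ℕ) (b : τ → Fin d → ℝ), ∀ i j, G i j = ∑ k, b i k * b j k := by
  classical
  obtain ⟨B, rfl⟩ := CStarAlgebra.nonneg_iff_eq_star_mul_self.mp hG.nonneg
  refine ⟨Fintype.card τ, fun i k => B ((Fintype.equivFin τ).symm k) i, fun i j => ?_⟩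
  rw [Equiv.sum_comp (Fintype.equivFin τ).symm (fun k => B k i * B k j)]
  simp [Matrix.mul_apply]

theorem abs_apply_le_one_of_mem_gramSet {G : Matrix τ τ ℝ} (hG : G ∈ gramSet τ) (i j : τ) :
    |G i j| ≤ 1 := by
  obtain ⟨d, b, hb⟩ := exists_gram_of_posSemidef hG.1
  have hi := hG.2 i
  have hj := hG.2 j
  rw [hb] at hi hj ⊢
  have h1 : 0 ≤ ∑ k, (b i k + b j k) ^ 2 := sum_nonneg fun _ _ => sq_nonneg _
  have h2 : 0 ≤ ∑ k, (b i k - b j k) ^ 2 := sum_nonneg fun _ _ => sq_nonneg _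
  have e1 : ∀ k, (b i k + b j k) ^ 2 = b i k * b i k + 2 * (b i k * b j k) + b j k * b j k := by
    intro k; ring
  have e2 : ∀ k, (b i k - b j k) ^ 2 = b i k * b i k - 2 * (b i k * b j k) + b j k * b j k := by
    intro k; ring
  simp only [e1, e2, sum_add_distrib, sum_sub_distrib, ← mul_sum] at h1 h2
  rw [abs_le]
  constructor <;> linarith

theorem isCompact_gramSet : IsCompact (gramSet τ) := by
  have hK : IsCompact (Set.univ.pi fun _ : τ => Set.univ.pi fun _ : τ => Set.Icc (-1 : ℝ) 1) :=
    isCompact_univ_pi fun _ => isCompact_univ_pi fun _ => isCompact_Icc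
  refine hK.of_isClosed_subset ?_ ?_
  · have : gramSet τ = {G : Matrix τ τ ℝ | G.conjTranspose = G} ∩
        (⋂ x : τ → ℝ, {G | 0 ≤ star x ⬝ᵥ G.mulVec x}) ∩ ⋂ i, {G | G i i ≤ 1} := by
      ext G
      simp only [gramSet, Matrix.posSemidef_iff_dotProduct_mulVec, Matrix.IsHermitian,
        Set.mem_inter_iff, Set.mem_iInter, Set.mem_ofPred_eq]
    rw [this]
    refine ((isClosed_eq (by fun_prop) continuous_id).inter
      (isClosed_iInter fun x => isClosed_le continuous_const ?_)).inter
      (isClosed_iInter fun i => isClosed_le ?_ continuous_const)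
    · fun_prop
    · fun_prop
  · intro G hG i _ j _
    exact abs_le.mp (abs_apply_le_one_of_mem_gramSet hG i j)

end Gram

section Factorization

variable {ι κ : Type*} [Fintype ι] [Fintype κ]

/-- The pairing of `N` with the upper right block of `G`. -/
def crossForm (N : Matrix ι κ ℝ) (G : Matrix (ι ⊕ κ) (ι ⊕ κ) ℝ) : ℝ :=
  ∑ i, ∑ j, N i j * G (Sum.inl i) (Sum.inr j)

theorem exists_isMaxOn_crossForm (N : Matrix ι κ ℝ) :
    ∃ G ∈ gramSet (ι ⊕ κ), ∀ H ∈ gramSet (ι ⊕ κ), crossForm N H ≤ crossForm N G := by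
  have hne : (gramSet (ι ⊕ κ)).Nonempty := ⟨0, Matrix.PosSemidef.zero, by simp⟩
  have hc : Continuous fun G : Matrix (ι ⊕ κ) (ι ⊕ κ) ℝ => crossForm N G := by
    unfold crossForm
    fun_prop
  obtain ⟨G, hG, hmax⟩ := isCompact_gramSet.exists_isMaxOn hne hc.continuousOn
  exact ⟨G, hG, fun H hH => hmax hH⟩

theorem crossForm_smul (N : Matrix ι κ ℝ) (c : ℝ) (G : Matrix (ι ⊕ κ) (ι ⊕ κ) ℝ) :
    crossForm N (c • G) = c * crossForm N G := by
  simp only [crossForm, Matrix.smul_apply, smul_eq_mul, mul_sum]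
  exact sum_congr rfl fun _ _ => sum_congr rfl fun _ _ => by ring

/-- The pairing of `N` with the inner products of two families of vectors. -/
theorem sum_mul_inner_le {N : Matrix ι κ ℝ} {S : ℝ}
    (hS : ∀ H ∈ gramSet (ι ⊕ κ), crossForm N H ≤ S) {Ω : Type*} [Fintype Ω]
    (f : ι → Ω → ℝ) (g : κ → Ω → ℝ) {a b : ℝ} (ha : 0 < a) (hb : 0 < b)
    (hf : ∀ i, ∑ ω, f i ω ^ 2 ≤ a ^ 2) (hg : ∀ j, ∑ ω, g j ω ^ 2 ≤ b ^ 2) :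
    ∑ i, ∑ j, N i j * ∑ ω, f i ω * g j ω ≤ a * b * S := by
  have key := hS (Matrix.of fun s t => ∑ ω, (Sum.elim (fun i ω => f i ω / a)
      (fun j ω => g j ω / b) s : Ω → ℝ) ω * (Sum.elim (fun i ω => f i ω / a)
      (fun j ω => g j ω / b) t : Ω → ℝ) ω) ⟨posSemidef_gram _, ?_⟩
  · have e : ∀ i j, ∑ ω, f i ω / a * (g j ω / b) = (∑ ω, f i ω * g j ω) / (a * b) := by
      intro i j
      rw [sum_div]
      exact sum_congr rfl fun ω _ => by field_simp
    simp only [crossForm, Matrix.of_apply, Sum.elim_inl, Sum.elim_inr, e] at key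
    simp only [← mul_div_assoc, ← sum_div] at key
    rw [div_le_iff₀ (by positivity)] at key
    linarith
  · rintro (i | j)
    · simp only [Matrix.of_apply, Sum.elim_inl, ← sq, div_pow, ← sum_div]
      exact div_le_one_of_le₀ (hf i) (by positivity)
    · simp only [Matrix.of_apply, Sum.elim_inr, ← sq, div_pow, ← sum_div]
      exact div_le_one_of_le₀ (hg j) (by positivity)

/-- **Grothendieck's inequality** with constant `98`. -/
theorem crossForm_le {N : Matrix ι κ ℝ} {β : ℝ}
    (hβ : ∀ (x : ι → ℝ) (y : κ → ℝ), (∀ i, |x i| ≤ 1) → (∀ j, |y j| ≤ 1) →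
      ∑ i, ∑ j, N i j * (x i * y j) ≤ β)
    {G : Matrix (ι ⊕ κ) (ι ⊕ κ) ℝ} (hG : G ∈ gramSet (ι ⊕ κ)) : crossForm N G ≤ 98 * β := by
  obtain ⟨G₀, hG₀, hmax⟩ := exists_isMaxOn_crossForm N
  refine (hmax G hG).trans ?_
  clear hG G
  obtain ⟨d, b, hb⟩ := exists_gram_of_posSemidef hG₀.1
  have hb1 : ∀ s, ∑ k, b s k ^ 2 ≤ 1 := by
    intro s
    have := hG₀.2 s
    rw [hb] at this
    simpa [sq] using this
  set S := crossForm N G₀ with hSdef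
  set q : ℝ := √(2 ^ d) with hq
  have hq0 : 0 < q := by positivity
  have hq2 : q ^ 2 = 2 ^ d := Real.sq_sqrt (by positivity)
  let f : ι → (Fin d → Bool) → ℝ := fun i => signSum (b (Sum.inl i))
  let g : κ → (Fin d → Bool) → ℝ := fun j => signSum (b (Sum.inr j))
  have hsq : ∀ s, ∑ ω, signSum (b s) ω ^ 2 ≤ q ^ 2 := by
    intro s
    rw [sum_signSum_sq, hq2]
    exact mul_le_of_le_one_right (by positivity) (hb1 s)
  have htr : ∀ s, ∑ ω, trunc (signSum (b s) ω) ^ 2 ≤ q ^ 2 := fun s =>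
    (sum_le_sum fun ω _ => trunc_sq_le _).trans (hsq s)
  -- The level 7 is chosen so that 3/49 ≤ 1/16: the tails have at most a quarter of the allowed
  -- norm.
  have hrem : ∀ s, ∑ ω, (signSum (b s) ω - trunc (signSum (b s) ω)) ^ 2 ≤ (q / 4) ^ 2 := by
    intro s
    calc ∑ ω, (signSum (b s) ω - trunc (signSum (b s) ω)) ^ 2
        ≤ ∑ ω, signSum (b s) ω ^ 4 / 49 := sum_le_sum fun ω _ => sub_trunc_sq_le _
      _ = (∑ ω, signSum (b s) ω ^ 4) / 49 := by rw [sum_div]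
      _ ≤ (3 * 2 ^ d * (∑ k, b s k ^ 2) ^ 2) / 49 := by
          gcongr; exact sum_signSum_pow_four_le _
      _ ≤ (3 * 2 ^ d * 1) / 49 := by
          gcongr
          exact pow_le_one₀ (sum_nonneg fun _ _ => sq_nonneg _) (hb1 s)
      _ ≤ (q / 4) ^ 2 := by
          rw [div_pow, hq2]
          have : (0 : ℝ) < 2 ^ d := by positivity
          linarith
  have t2 := sum_mul_inner_le hmax (fun i ω => trunc (f i ω)) (fun j ω => g j ω - trunc (g j ω))
    hq0 (by positivity : 0 < q / 4) (fun i => htr _) (fun j => hrem _)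
  have t3 := sum_mul_inner_le hmax (fun i ω => f i ω - trunc (f i ω)) (fun j ω => g j ω)
    (by positivity : 0 < q / 4) hq0 (fun i => hrem _) (fun j => hsq _)
  have t1 : ∑ i, ∑ j, N i j * ∑ ω, trunc (f i ω) * trunc (g j ω) ≤ q ^ 2 * (49 * β) := by
    have e : ∑ i, ∑ j, N i j * ∑ ω, trunc (f i ω) * trunc (g j ω) =
        ∑ ω, 49 * ∑ i, ∑ j, N i j * (trunc (f i ω) / 7 * (trunc (g j ω) / 7)) := by
      simp only [mul_sum]
      conv_rhs => rw [sum_comm]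
      refine sum_congr rfl fun i _ => ?_
      conv_rhs => rw [sum_comm]
      exact sum_congr rfl fun j _ => sum_congr rfl fun ω _ => by ring
    rw [e]
    have hx : ∀ x, |trunc x / 7| ≤ 1 := by
      intro x
      rw [abs_div, abs_of_pos (by norm_num : (0 : ℝ) < 7)]
      exact div_le_one_of_le₀ (abs_trunc_le x) (by norm_num)
    calc _ ≤ ∑ _ω : Fin d → Bool, 49 * β := by
          refine sum_le_sum fun ω _ => ?_
          gcongr
          exact hβ _ _ (fun _ => hx _) (fun _ => hx _)
      _ = q ^ 2 * (49 * β) := by simp [hq2]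
  have t0 : q ^ 2 * S = ∑ i, ∑ j, N i j * ∑ ω, f i ω * g j ω := by
    simp only [f, g, sum_signSum_mul, hSdef, crossForm, hb, hq2, mul_sum]
    exact sum_congr rfl fun i _ => sum_congr rfl fun j _ => sum_congr rfl fun k _ => by ring
  have tsplit : ∑ i, ∑ j, N i j * ∑ ω, f i ω * g j ω =
      ∑ i, ∑ j, N i j * ∑ ω, trunc (f i ω) * trunc (g j ω) +
      ∑ i, ∑ j, N i j * ∑ ω, trunc (f i ω) * (g j ω - trunc (g j ω)) +
      ∑ i, ∑ j, N i j * ∑ ω, (f i ω - trunc (f i ω)) * g j ω := by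
    simp only [← sum_add_distrib, ← mul_add]
    refine sum_congr rfl fun i _ => sum_congr rfl fun j _ => ?_
    congr 1
    exact sum_congr rfl fun ω _ => by ring
  have hq2pos : 0 < q ^ 2 := by positivity
  -- Self-improvement: the truncated parts give 49β by the cube bound, and each tail term is again
  -- bounded through the maximality of S, by S/4. So S ≤ 49β + S/2.
  have : q ^ 2 * S ≤ q ^ 2 * (98 * β) := by nlinarith
  exact le_of_mul_le_mul_left this hq2pos

/-- The dual form of Grothendieck's inequality: a bilinear form that is bounded by `β` on the
product of two cubes is dominated by two weighted Euclidean norms of total weight `98 * β`. -/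
theorem exists_dominating_weights {N : Matrix ι κ ℝ} {β : ℝ}
    (hβ : ∀ (x : ι → ℝ) (y : κ → ℝ), (∀ i, |x i| ≤ 1) → (∀ j, |y j| ≤ 1) →
      ∑ i, ∑ j, N i j * (x i * y j) ≤ β) :
    ∃ (a : ι → ℝ) (b : κ → ℝ), ∑ i, a i ≤ 98 * β ∧ ∑ j, b j ≤ 98 * β ∧
      ∀ (x : ι → ℝ) (y : κ → ℝ), ∑ i, ∑ j, N i j * (x i * y j) ≤
        (∑ i, a i * x i ^ 2 + ∑ j, b j * y j ^ 2) / 2 := by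
  obtain ⟨G, hG, hmax⟩ := exists_isMaxOn_crossForm N
  have hS := crossForm_le hβ hG
  obtain ⟨d, v, hv⟩ := exists_gram_of_posSemidef hG.1
  have hv1 : ∀ s, ∑ k, v s k ^ 2 ≤ 1 := by
    intro s
    have := hG.2 s
    rw [hv] at this
    simpa [sq] using this
  set E : ι → κ → ℝ := fun i j => N i j * G (Sum.inl i) (Sum.inr j) with hE
  -- The weights are the Lagrange multipliers of the unit-norm constraints at the maximizer `G`;
  -- each family sums to S.
  refine ⟨fun i => ∑ j, E i j, fun j => ∑ i, E i j, hS, ?_, fun x y => ?_⟩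
  · rw [sum_comm]; exact hS
  set S := crossForm N G with hSdef
  have hSE : S = ∑ i, ∑ j, E i j := rfl
  set Cx := ∑ i, x i ^ 4 with hCx
  set Cy := ∑ j, y j ^ 4 with hCy
  have hCx0 : 0 ≤ Cx := sum_nonneg fun _ _ => by positivity
  have hCy0 : 0 ≤ Cy := sum_nonneg fun _ _ => by positivity
  set R := ∑ i, ∑ j, E i j * (x i ^ 2 * y j ^ 2 / 4) with hR
  set Q := ∑ i, ∑ j, N i j * (x i * y j) -
    (∑ i, (∑ j, E i j) * x i ^ 2 + ∑ j, (∑ i, E i j) * y j ^ 2) / 2 with hQ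
  -- Second-order variation at the maximizer: shrink each vector by 1 - δ²w²/2 and add a new
  -- coordinate δw, with w = x i or y j. The squared norms exceed 1 only at order δ⁴, while the form
  -- changes by δ²Q.
  have key : ∀ δ : ℝ, 0 < δ → Q ≤ δ ^ 2 * ((Cx + Cy) * S - R) := by
    intro δ hδ
    have hpert : ∀ (w C : ℝ) (s : ι ⊕ κ), w ^ 4 ≤ C → ∑ o : Option (Fin d),
        (o.elim (δ * w) fun k => (1 - δ ^ 2 * w ^ 2 / 2) * v s k) ^ 2 ≤ 1 + δ ^ 4 * C := by
      intro w C s hw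
      simp only [Fintype.sum_option, Option.elim, mul_pow, ← mul_sum]
      have h1 : (1 - δ ^ 2 * w ^ 2 / 2) ^ 2 * ∑ k, v s k ^ 2 ≤ (1 - δ ^ 2 * w ^ 2 / 2) ^ 2 :=
        mul_le_of_le_one_right (sq_nonneg _) (hv1 s)
      have h2 : δ ^ 4 * w ^ 4 ≤ δ ^ 4 * C := by gcongr
      have h3 : 0 ≤ δ ^ 4 * w ^ 4 := by positivity
      nlinarith
    have hroot : (0 : ℝ) < 1 + δ ^ 4 * (Cx + Cy) := by positivity
    have h := sum_mul_inner_le hmax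
      (fun i (o : Option (Fin d)) =>
        o.elim (δ * x i) fun k => (1 - δ ^ 2 * x i ^ 2 / 2) * v (Sum.inl i) k)
      (fun j (o : Option (Fin d)) =>
        o.elim (δ * y j) fun k => (1 - δ ^ 2 * y j ^ 2 / 2) * v (Sum.inr j) k)
      (Real.sqrt_pos.mpr hroot) (Real.sqrt_pos.mpr hroot)
      (fun i => by
        rw [Real.sq_sqrt hroot.le]
        refine hpert _ _ _ ?_
        have := single_le_sum (f := fun i => x i ^ 4) (fun _ _ => by positivity) (mem_univ i)
        linarith)
      (fun j => by
        rw [Real.sq_sqrt hroot.le]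
        refine hpert _ _ _ ?_
        have := single_le_sum (f := fun j => y j ^ 4) (fun _ _ => by positivity) (mem_univ j)
        linarith)
    rw [Real.mul_self_sqrt hroot.le] at h
    have e : ∑ i, ∑ j, N i j * ∑ o : Option (Fin d),
        (o.elim (δ * x i) fun k => (1 - δ ^ 2 * x i ^ 2 / 2) * v (Sum.inl i) k) *
        (o.elim (δ * y j) fun k => (1 - δ ^ 2 * y j ^ 2 / 2) * v (Sum.inr j) k) =
        S + δ ^ 2 * Q + δ ^ 4 * R := by
      have e1 : ∀ i j, N i j * ∑ o : Option (Fin d),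
          (o.elim (δ * x i) fun k => (1 - δ ^ 2 * x i ^ 2 / 2) * v (Sum.inl i) k) *
          (o.elim (δ * y j) fun k => (1 - δ ^ 2 * y j ^ 2 / 2) * v (Sum.inr j) k) =
          E i j + δ ^ 2 * (N i j * (x i * y j)) - δ ^ 2 / 2 * (E i j * x i ^ 2) -
            δ ^ 2 / 2 * (E i j * y j ^ 2) + δ ^ 4 * (E i j * (x i ^ 2 * y j ^ 2 / 4)) := by
        intro i j
        simp only [Fintype.sum_option, Option.elim, hE, hv]
        have : ∀ k, (1 - δ ^ 2 * x i ^ 2 / 2) * v (Sum.inl i) k *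
            ((1 - δ ^ 2 * y j ^ 2 / 2) * v (Sum.inr j) k) =
            (1 - δ ^ 2 * x i ^ 2 / 2) * (1 - δ ^ 2 * y j ^ 2 / 2) *
              (v (Sum.inl i) k * v (Sum.inr j) k) := by
          intro k; ring
        simp only [this, ← mul_sum]
        ring
      have e2 : ∑ j, (∑ i, E i j) * y j ^ 2 = ∑ i, ∑ j, E i j * y j ^ 2 := by
        rw [sum_comm]
        simp only [sum_mul]
      simp only [e1, sum_add_distrib, sum_sub_distrib, ← mul_sum, hQ, hR, hSE, e2]
      simp only [sum_mul]
      ring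
    rw [e] at h
    have hδ2 : 0 < δ ^ 2 := by positivity
    refine le_of_mul_le_mul_left ?_ hδ2
    linarith [show δ ^ 2 * (δ ^ 2 * ((Cx + Cy) * S - R)) =
      (1 + δ ^ 4 * (Cx + Cy)) * S - S - δ ^ 4 * R by ring]
  have hQ0 : Q ≤ 0 := by
    by_contra! hpos
    set D := (Cx + Cy) * S - R
    -- This δ² makes the right side at most Q/2, contradicting Q > 0.
    have h := key √(Q / (2 * (|D| + 1))) (Real.sqrt_pos.mpr (by positivity))
    rw [Real.sq_sqrt (by positivity)] at h
    have h2 : Q / (2 * (|D| + 1)) * D ≤ Q / (2 * (|D| + 1)) * (|D| + 1) := by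
      gcongr
      linarith [le_abs_self D]
    have h3 : Q / (2 * (|D| + 1)) * (|D| + 1) = Q / 2 := by
      have : |D| + 1 ≠ 0 := by positivity
      field_simp
    linarith
  linarith

/-- A matrix dominated by two weighted Euclidean norms has small weighted Frobenius norm. -/
theorem sum_sq_div_le_rank {N : Matrix ι κ ℝ} {a : ι → ℝ} {b : κ → ℝ}
    (ha : ∀ i, 0 < a i) (hb : ∀ j, 0 < b j)
    (h : ∀ (x : ι → ℝ) (y : κ → ℝ), ∑ i, ∑ j, N i j * (x i * y j) ≤
      (∑ i, a i * x i ^ 2 + ∑ j, b j * y j ^ 2) / 2) :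
    ∑ i, ∑ j, N i j ^ 2 / (a i * b j) ≤ N.rank := by
  classical
  set Z : Matrix ι κ ℝ := Matrix.diagonal (fun i => (√(a i))⁻¹) * N *
    Matrix.diagonal (fun j => (√(b j))⁻¹) with hZ
  have hZapp : ∀ i j, Z i j = N i j * ((√(a i))⁻¹ * (√(b j))⁻¹) := by
    intro i j
    simp [hZ, Matrix.diagonal_mul, Matrix.mul_diagonal]
    ring
  have hrank : (Z * Z.conjTranspose).rank ≤ N.rank := by
    rw [Matrix.rank_self_mul_conjTranspose]
    exact (Matrix.rank_mul_le_left _ _).trans (Matrix.rank_mul_le_right _ _)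
  have hA : (Z * Z.conjTranspose).IsHermitian := Matrix.isHermitian_mul_conjTranspose_self Z
  have htrace : ∑ i, ∑ j, N i j ^ 2 / (a i * b j) = (Z * Z.conjTranspose).trace := by
    simp only [Matrix.trace, Matrix.diag, Matrix.mul_apply, Matrix.conjTranspose_apply,
      star_trivial, hZapp]
    refine sum_congr rfl fun i _ => sum_congr rfl fun j _ => ?_
    have h1 : √(a i) ≠ 0 := (Real.sqrt_pos.mpr (ha i)).ne'
    have h2 : √(b j) ≠ 0 := (Real.sqrt_pos.mpr (hb j)).ne'
    nth_rewrite 1 [← Real.sq_sqrt (ha i).le, ← Real.sq_sqrt (hb j).le]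
    field_simp
  have heig : ∀ i, hA.eigenvalues i ≤ 1 := by
    intro i
    set v : ι → ℝ := ⇑(hA.eigenvectorBasis i) with hvdef
    have hv : ∑ k, v k ^ 2 = 1 := by
      have := hA.eigenvectorBasis.orthonormal.1 i
      have h2 : ‖hA.eigenvectorBasis i‖ ^ 2 = 1 := by rw [this]; norm_num
      rwa [EuclideanSpace.real_norm_sq_eq] at h2
    set u : κ → ℝ := Z.transpose.mulVec v with hu
    have e1 : hA.eigenvalues i = v ⬝ᵥ Z.mulVec u := by
      rw [hA.eigenvalues_eq, hu, Matrix.mulVec_mulVec]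
      rfl
    have e2 : hA.eigenvalues i = ∑ j, u j ^ 2 := by
      rw [e1, Matrix.dotProduct_mulVec, ← Matrix.mulVec_transpose, ← hu, dotProduct]
      simp [sq]
    -- Testing on an eigenvector v of ZZᵀ and u = Zᵀv, rescaled, gives λ ≤ (1 + λ)/2, hence λ ≤ 1.
    -- The trace is then at most the number of nonzero eigenvalues, which is the rank.
    have h1 := h (fun i => v i * (√(a i))⁻¹) (fun j => u j * (√(b j))⁻¹)
    have e3 : ∑ i, ∑ j, N i j * (v i * (√(a i))⁻¹ * (u j * (√(b j))⁻¹)) = v ⬝ᵥ Z.mulVec u := by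
      simp only [dotProduct, Matrix.mulVec, hZapp, mul_sum]
      exact sum_congr rfl fun i _ => sum_congr rfl fun j _ => by ring
    have e4 : ∀ {c t : ℝ}, 0 < c → c * (t * (√c)⁻¹) ^ 2 = t ^ 2 := by
      intro c t hc
      rw [mul_pow, inv_pow, Real.sq_sqrt hc.le]
      field_simp
    simp only [e3, e4 (ha _), e4 (hb _), ← e1, ← e2, hv] at h1
    linarith
  rw [htrace, hA.trace_eq_sum_eigenvalues]
  refine le_trans ?_ (Nat.cast_le.mpr hrank)
  rw [hA.rank_eq_card_non_zero_eigs, Fintype.card_subtype]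
  rw [card_filter, Nat.cast_sum]
  refine sum_le_sum fun i _ => ?_
  by_cases h0 : hA.eigenvalues i = 0
  · rw [if_neg (not_not_intro h0), h0]
    simp
  · rw [if_pos h0, Nat.cast_one]
    exact heig i

end Factorization

/-! ### Discrepancy of low-rank binary matrices -/

section Discrepancy

variable {ι κ : Type*} [Fintype ι] [Fintype κ]

/-- The sum is at most the ℓ¹ norm of `c`, which splits into its nonnegative and negative parts,
each a subset sum. -/
theorem sum_mul_le_of_forall_subset {c z : κ → ℝ} {A B : ℝ} (hz : ∀ j, |z j| ≤ 1)
    (hA : ∀ Q : Finset κ, ∑ j ∈ Q, c j ≤ A) (hB : ∀ Q : Finset κ, -B ≤ ∑ j ∈ Q, c j) :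
    ∑ j, c j * z j ≤ A + B := by
  have h1 : ∑ j, c j * z j ≤ ∑ j, |c j| := by
    refine sum_le_sum fun j _ => (le_abs_self _).trans ?_
    rw [abs_mul]
    exact mul_le_of_le_one_right (abs_nonneg _) (hz j)
  rw [← sum_filter_add_sum_filter_not univ (fun j => 0 ≤ c j) (fun j => |c j|)] at h1
  have h2 : ∑ j with 0 ≤ c j, |c j| = ∑ j with 0 ≤ c j, c j :=
    sum_congr rfl fun j hj => abs_of_nonneg (mem_filter.mp hj).2
  have h3 : ∑ j with ¬ 0 ≤ c j, |c j| = -∑ j with ¬ 0 ≤ c j, c j := by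
    rw [← sum_neg_distrib]
    exact sum_congr rfl fun j hj => abs_of_neg (not_le.mp (mem_filter.mp hj).2)
  rw [h2, h3] at h1
  linarith [hA {j | 0 ≤ c j}, hB {j | ¬ 0 ≤ c j}]

/-- The norm of a bilinear form on cubes is controlled by its values on rectangles. -/
theorem sum_mul_mul_le_of_forall_rectangle {N : Matrix ι κ ℝ} {A B : ℝ}
    (hA : ∀ (X : Finset ι) (Y : Finset κ), ∑ i ∈ X, ∑ j ∈ Y, N i j ≤ A)
    (hB : ∀ (X : Finset ι) (Y : Finset κ), -B ≤ ∑ i ∈ X, ∑ j ∈ Y, N i j)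
    {x : ι → ℝ} {y : κ → ℝ} (hx : ∀ i, |x i| ≤ 1) (hy : ∀ j, |y j| ≤ 1) :
    ∑ i, ∑ j, N i j * (x i * y j) ≤ 2 * (A + B) := by
  have hX : ∀ (X : Finset ι) (z : κ → ℝ), (∀ j, |z j| ≤ 1) →
      ∑ i ∈ X, ∑ j, N i j * z j ≤ A + B := by
    intro X z hz
    rw [sum_comm]
    simp only [← sum_mul]
    exact sum_mul_le_of_forall_subset hz (fun Q => by rw [sum_comm]; exact hA X Q)
      (fun Q => by rw [sum_comm]; exact hB X Q)
  have h := sum_mul_le_of_forall_subset (c := fun i => ∑ j, N i j * y j) hx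
    (fun X => hX X y hy) (B := A + B) (fun X => by
      have := hX X (fun j => -y j) (fun j => by simpa using hy j)
      simp only [mul_neg, sum_neg_distrib] at this
      linarith)
  calc _ = ∑ i, (∑ j, N i j * y j) * x i := by
        refine sum_congr rfl fun i _ => ?_
        rw [sum_mul]
        exact sum_congr rfl fun j _ => by ring
    _ ≤ 2 * (A + B) := by linarith

/-- If every set of values of `f` has small excess over the mean `q`, then few of them are lost by
removing the large ones together with those of large weight `w`. -/
theorem sum_filter_not_le {f w : ι → ℝ} {q D S : ℝ} (hq : 0 ≤ q) (hS : 0 < S)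
    (hw0 : ∀ i, 0 ≤ w i) (hw : ∑ i, w i ≤ 2 * S)
    (hD : ∀ X : Finset ι, ∑ i ∈ X, (f i - q) ≤ D) :
    ∑ i with ¬ (f i ≤ 2 * q ∧ w i * Fintype.card ι ≤ 32 * S), f i ≤
      2 * D + q * Fintype.card ι / 8 := by
  set m := (Fintype.card ι : ℝ)
  have hm : 0 ≤ m := Nat.cast_nonneg _
  rw [← sum_filter_add_sum_filter_not _ (fun i => ¬ f i ≤ 2 * q) f]
  refine add_le_add ?_ ?_
  · have h := hD (filter (fun i => ¬ f i ≤ 2 * q)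
      (filter (fun i => ¬ (f i ≤ 2 * q ∧ w i * m ≤ 32 * S)) univ))
    refine le_trans ?_ (mul_le_mul_of_nonneg_left h zero_le_two)
    rw [mul_sum]
    refine sum_le_sum fun i hi => ?_
    have := (mem_filter.mp hi).2
    linarith
  -- Markov: at most 1/16 of the indices have large weight, and each remaining one contributes at
  -- most 2q.
  · calc _ ≤ ∑ i, 2 * q * (w i * m / (32 * S)) := by
          refine (sum_le_sum fun i hi => ?_).trans
            (sum_le_sum_of_subset_of_nonneg (subset_univ _) fun i _ _ => ?_)
          · simp only [mem_filter, mem_univ, true_and, not_and, not_le, not_lt] at hi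
            refine hi.2.trans (le_mul_of_one_le_right (by positivity) ?_)
            rw [one_le_div (by positivity)]
            exact (hi.1 hi.2).le
          · have := hw0 i
            positivity
      _ = 2 * q * (m / (32 * S)) * ∑ i, w i := by
          rw [mul_sum]
          exact sum_congr rfl fun i _ => by ring
      _ ≤ 2 * q * (m / (32 * S)) * (2 * S) := by gcongr
      _ = q * m / 8 := by field_simp; ring

theorem sum_sub_le_sum_rectangle {M : Matrix ι κ ℝ} (hM : ∀ i j, 0 ≤ M i j)
    (P : ι → Prop) (Q : κ → Prop) [DecidablePred P] [DecidablePred Q] :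
    ∑ i, ∑ j, M i j - ∑ i with ¬ P i, ∑ j, M i j - ∑ j with ¬ Q j, ∑ i, M i j ≤
      ∑ i with P i, ∑ j with Q j, M i j := by
  have h1 := sum_filter_add_sum_filter_not univ P fun i => ∑ j, M i j
  have h2 : ∑ i with P i, ∑ j, M i j =
      ∑ i with P i, ∑ j with Q j, M i j + ∑ i with P i, ∑ j with ¬ Q j, M i j := by
    rw [← sum_add_distrib]
    exact sum_congr rfl fun i _ => (sum_filter_add_sum_filter_not univ Q _).symm
  have h3 : ∑ i with P i, ∑ j with ¬ Q j, M i j ≤ ∑ j with ¬ Q j, ∑ i, M i j := by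
    refine sum_comm.le.trans ?_
    exact sum_le_sum fun j _ => sum_le_sum_of_subset_of_nonneg (subset_univ _) fun i _ _ => hM i j
  linarith

/-- A constant matrix is an outer product, and rank is subadditive. -/
theorem rank_sub_const_le {α : Type*} (M : Matrix α κ ℝ) (p : ℝ) :
    (Matrix.of fun i j => M i j - p).rank ≤ M.rank + 1 := by
  have h : (Matrix.of fun i j => M i j - p) =
      M + Matrix.vecMulVec (fun _ => (1 : ℝ)) (fun _ => -p) := by
    ext i j
    simp [Matrix.vecMulVec_apply, sub_eq_add_neg]
  rw [h]
  refine le_trans ?_ (Nat.add_le_add_left (Matrix.rank_vecMulVec_le (fun _ : α => (1 : ℝ))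
    (fun _ : κ => -p)) _)
  rw [Matrix.rank, Matrix.rank, Matrix.rank, Matrix.mulVecLin_add]
  exact (Submodule.finrank_mono (LinearMap.range_add_le _ _)).trans
    (Submodule.finrank_add_le_finrank_add_finrank _ _)

/-- A matrix with small sums over rectangles has small weighted Frobenius norm. -/
theorem exists_weights_sum_sq_div_le_rank [Nonempty ι] [Nonempty κ] {N : Matrix ι κ ℝ} {δ : ℝ}
    (hδ0 : 0 < δ)
    (hup : ∀ (X : Finset ι) (Y : Finset κ), ∑ i ∈ X, ∑ j ∈ Y, N i j ≤ 3 * δ)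
    (hlow : ∀ (X : Finset ι) (Y : Finset κ), -δ ≤ ∑ i ∈ X, ∑ j ∈ Y, N i j) :
    ∃ (a : ι → ℝ) (b : κ → ℝ), (∀ i, 0 < a i) ∧ (∀ j, 0 < b j) ∧ ∑ i, a i ≤ 2 * (784 * δ) ∧
      ∑ j, b j ≤ 2 * (784 * δ) ∧ ∑ i, ∑ j, N i j ^ 2 / (a i * b j) ≤ N.rank := by
  classical
  set m := (Fintype.card ι : ℝ) with hmdef
  set n := (Fintype.card κ : ℝ) with hndef
  have hm : 0 < m := Nat.cast_pos.mpr Fintype.card_pos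
  have hn : 0 < n := Nat.cast_pos.mpr Fintype.card_pos
  obtain ⟨a, b, ha, hb, hab⟩ := exists_dominating_weights (N := N) (β := 8 * δ)
    fun x y hx hy => by
      linarith [sum_mul_mul_le_of_forall_rectangle hup hlow hx hy]
  have ha0 : ∀ i, 0 ≤ a i := by
    intro i
    have := hab (Pi.single i 1) 0
    simp [Pi.single_apply] at this
    linarith
  have hb0 : ∀ j, 0 ≤ b j := by
    intro j
    have := hab 0 (Pi.single j 1)
    simp [Pi.single_apply] at this
    linarith
  set S := 784 * δ with hS
  have hS0 : 0 < S := by positivity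
  -- Adding S/m (and S/n below) makes the weights strictly positive, so that they can be inverted,
  -- while each total at most doubles. Here 784 = 98 · 8.
  set a' : ι → ℝ := fun i => a i + S / m with ha'
  set b' : κ → ℝ := fun j => b j + S / n with hb'
  have ha'0 : ∀ i, 0 < a' i := fun i => add_pos_of_nonneg_of_pos (ha0 i) (by positivity)
  have hb'0 : ∀ j, 0 < b' j := fun j => add_pos_of_nonneg_of_pos (hb0 j) (by positivity)
  have hsa : ∑ i, a' i ≤ 2 * S := by
    simp only [ha', sum_add_distrib, sum_const, card_univ, nsmul_eq_mul, ← hmdef]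
    rw [mul_div_cancel₀ _ hm.ne']
    linarith
  have hsb : ∑ j, b' j ≤ 2 * S := by
    simp only [hb', sum_add_distrib, sum_const, card_univ, nsmul_eq_mul, ← hndef]
    rw [mul_div_cancel₀ _ hn.ne']
    linarith
  exact ⟨a', b', ha'0, hb'0, hsa, hsb,
    sum_sq_div_le_rank ha'0 hb'0 fun x y => (hab x y).trans (by
      gcongr <;> exact le_add_of_nonneg_right (by positivity))⟩

/-- A binary matrix of rank at most `r` has a rectangle that is notably sparser than average. -/
theorem exists_sparse_rectangle [Nonempty ι] [Nonempty κ] {M : Matrix ι κ ℝ}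
    (hM : ∀ i j, M i j = 0 ∨ M i j = 1) {r : ℕ} (hr : 1 ≤ r) (hrank : M.rank ≤ r) {p : ℝ}
    (hp : ∑ i, ∑ j, M i j = p * (Fintype.card ι * Fintype.card κ))
    (hp1 : 1 / (4 * r) ≤ p) (hp2 : p ≤ 1 / 2) :
    ∃ (X : Finset ι) (Y : Finset κ),
      1 / 200000 * (Fintype.card ι * Fintype.card κ) * √(p / r) ≤
        ∑ i ∈ X, ∑ j ∈ Y, (p - M i j) := by
  classical
  by_contra! hcon
  set m := (Fintype.card ι : ℝ) with hmdef
  set n := (Fintype.card κ : ℝ) with hndef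
  have hm : 0 < m := Nat.cast_pos.mpr Fintype.card_pos
  have hn : 0 < n := Nat.cast_pos.mpr Fintype.card_pos
  have hr0 : (0 : ℝ) < r := by exact_mod_cast hr
  have hp0 : 0 < p := lt_of_lt_of_le (by positivity) hp1
  set t := √(p / r) with ht
  have ht0 : 0 < t := Real.sqrt_pos.mpr (by positivity)
  have htsq : t ^ 2 = p / r := Real.sq_sqrt (by positivity)
  -- This is where p ≥ 1/(4r) enters: it makes δ small compared with the number of ones.
  have htp : t ≤ 2 * p := by
    rw [ht, Real.sqrt_le_left (by positivity), div_le_iff₀ hr0]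
    rw [div_le_iff₀ (by positivity)] at hp1
    nlinarith
  set δ := 1 / 200000 * (m * n) * t with hδ
  have hδ0 : 0 < δ := by positivity
  set N : Matrix ι κ ℝ := Matrix.of fun i j => M i j - p with hN
  have hlow : ∀ (X : Finset ι) (Y : Finset κ), -δ ≤ ∑ i ∈ X, ∑ j ∈ Y, N i j := by
    intro X Y
    have h := hcon X Y
    have e : ∑ i ∈ X, ∑ j ∈ Y, N i j = -∑ i ∈ X, ∑ j ∈ Y, (p - M i j) := by
      simp only [← sum_neg_distrib, neg_sub, hN, Matrix.of_apply]
    linarith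
  have htot : ∑ i, ∑ j, N i j = 0 := by
    simp only [hN, Matrix.of_apply, sum_sub_distrib, hp]
    simp only [sum_const, card_univ, nsmul_eq_mul, ← hmdef, ← hndef]
    ring
  -- The total is zero, so the sum over X × Y is minus the sums over X × Yᶜ and Xᶜ × all columns,
  -- plus nothing else; the lower bound applies to these two.
  have hup : ∀ (X : Finset ι) (Y : Finset κ), ∑ i ∈ X, ∑ j ∈ Y, N i j ≤ 3 * δ := by
    intro X Y
    have h1 := sum_add_sum_compl X fun i => ∑ j, N i j
    have h2 : ∑ i ∈ X, ∑ j, N i j = ∑ i ∈ X, ∑ j ∈ Y, N i j + ∑ i ∈ X, ∑ j ∈ Yᶜ, N i j := by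
      rw [← sum_add_distrib]
      exact sum_congr rfl fun i _ => (sum_add_sum_compl Y _).symm
    linarith [hlow X Yᶜ, hlow Xᶜ univ]
  obtain ⟨a', b', ha'0, hb'0, hsa, hsb, hfrob⟩ := exists_weights_sum_sq_div_le_rank hδ0 hup hlow
  set S := 784 * δ with hS
  have hS0 : 0 < S := by positivity
  have hrankN : (N.rank : ℝ) ≤ 2 * r := by
    have : N.rank ≤ 2 * r := (rank_sub_const_le M p).trans (by omega)
    exact_mod_cast this
  have hrow := sum_filter_not_le (f := fun i => ∑ j, M i j) (w := a') (q := p * n) (D := 3 * δ)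
    (by positivity) hS0 (fun i => (ha'0 i).le) hsa (fun X => by
      refine le_trans (le_of_eq (sum_congr rfl fun i _ => ?_)) (hup X univ)
      simp only [hN, Matrix.of_apply, sum_sub_distrib, sum_const, card_univ, nsmul_eq_mul,
        ← hndef]
      ring)
  have hcol := sum_filter_not_le (f := fun j => ∑ i, M i j) (w := b') (q := p * m) (D := 3 * δ)
    (by positivity) hS0 (fun i => (hb'0 i).le) hsb (fun Y => by
      refine le_trans (le_of_eq ?_) (hup univ Y)
      refine Eq.trans (sum_congr rfl fun j _ => ?_) sum_comm
      simp only [hN, Matrix.of_apply, sum_sub_distrib, sum_const, card_univ, nsmul_eq_mul,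
        ← hmdef]
      ring)
  have hM0 : ∀ i j, 0 ≤ M i j := fun i j => by rcases hM i j with h | h <;> simp [h]
  have hrect := sum_sub_le_sum_rectangle hM0
    (fun i => ∑ j, M i j ≤ 2 * (p * n) ∧ a' i * Fintype.card ι ≤ 32 * S)
    (fun j => ∑ i, M i j ≤ 2 * (p * m) ∧ b' j * Fintype.card κ ≤ 32 * S)
  set A : Finset ι := {i | ∑ j, M i j ≤ 2 * (p * n) ∧ a' i * Fintype.card ι ≤ 32 * S} with hA
  set B : Finset κ := {j | ∑ i, M i j ≤ 2 * (p * m) ∧ b' j * Fintype.card κ ≤ 32 * S} with hB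
  have hδp : 12 * δ ≤ p * (m * n) / 4 := by
    have : t * (m * n) ≤ 2 * p * (m * n) := by gcongr
    have h0 : 0 < p * (m * n) := by positivity
    rw [hδ]
    linarith
  have hones : p * (m * n) / 2 ≤ ∑ i ∈ A, ∑ j ∈ B, M i j := by
    rw [hp] at hrect
    linarith
  -- On the kept rows and columns the product of weights is at most (32S)²/(mn), and an entry 1
  -- gives (1 - p)² ≥ 1/4, whence 4096 = 4 · 32².
  have hlower : ∑ i ∈ A, ∑ j ∈ B, M i j * (m * n / (4096 * S ^ 2)) ≤
      ∑ i, ∑ j, N i j ^ 2 / (a' i * b' j) := by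
    have hnn : ∀ i j, 0 ≤ N i j ^ 2 / (a' i * b' j) := fun i j =>
      div_nonneg (sq_nonneg _) (mul_pos (ha'0 i) (hb'0 j)).le
    refine le_trans (sum_le_sum fun i hi => (sum_le_sum fun j hj => ?_).trans
      (sum_le_sum_of_subset_of_nonneg (subset_univ _) fun j _ _ => hnn i j))
      (sum_le_sum_of_subset_of_nonneg (subset_univ _) fun i _ _ => sum_nonneg fun j _ => hnn i j)
    have hi' := (mem_filter.mp hi).2.2
    have hj' := (mem_filter.mp hj).2.2
    rcases hM i j with h | h
    · rw [h, zero_mul]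
      exact hnn i j
    · rw [h, one_mul, div_le_div_iff₀ (by positivity) (mul_pos (ha'0 i) (hb'0 j))]
      have h1 : a' i * m * (b' j * n) ≤ 32 * S * (32 * S) :=
        mul_le_mul hi' hj' (mul_nonneg (hb'0 j).le hn.le) (by positivity)
      have h2 : 1 / 4 ≤ N i j ^ 2 := by
        simp only [hN, Matrix.of_apply, h]
        nlinarith
      have h3 : 1 / 4 * (4096 * S ^ 2) ≤ N i j ^ 2 * (4096 * S ^ 2) := by gcongr
      linarith
  simp only [← sum_mul] at hlower
  have hfinal : p * (m * n) / 2 * (m * n / (4096 * S ^ 2)) ≤ 2 * r :=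
    (mul_le_mul_of_nonneg_right hones (by positivity)).trans
      (hlower.trans (hfrob.trans hrankN))
  have hSt : S = 784 / 200000 * (m * n) * t := by rw [hS, hδ]; ring
  have hS2 : S ^ 2 = (784 / 200000) ^ 2 * (m * n) ^ 2 * (p / r) := by
    rw [hSt, mul_pow, mul_pow, htsq]
  rw [← mul_div_assoc, div_le_iff₀ (by positivity), hS2] at hfinal
  have e : 2 * (r : ℝ) * (4096 * ((784 / 200000) ^ 2 * (m * n) ^ 2 * (p / r))) =
      8192 * (784 / 200000) ^ 2 * ((m * n) ^ 2 * p) := by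
    field_simp
    ring
  have hpos : 0 < (m * n) ^ 2 * p := by positivity
  rw [e] at hfinal
  -- The constant 1/200000 is small enough: 8192 · (784/200000)² < 1/2.
  nlinarith

end Discrepancy

/-! ### Sparse base case and density decrement -/

section ZeroRectangle

/-- A very sparse binary matrix of rank at most `r` vanishes on a quarter of its entries that
form a rectangle. -/
theorem exists_zero_rectangle_of_sparse {ι κ : Type*} [Fintype ι] [Fintype κ] [Nonempty κ]
    {M : Matrix ι κ ℝ} (hM : ∀ i j, M i j = 0 ∨ M i j = 1) {r : ℕ} (hr : 1 ≤ r)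
    (hrank : M.rank ≤ r)
    (hsparse : 4 * r * ∑ i, ∑ j, M i j ≤ Fintype.card ι * Fintype.card κ) :
    ∃ (X : Finset ι) (Y : Finset κ), (∀ i ∈ X, ∀ j ∈ Y, M i j = 0) ∧
      (Fintype.card ι : ℝ) ≤ 2 * #X ∧ (Fintype.card κ : ℝ) ≤ 2 * #Y := by
  classical
  set m := (Fintype.card ι : ℝ) with hmdef
  set n := (Fintype.card κ : ℝ) with hndef
  have hn : 0 < n := Nat.cast_pos.mpr Fintype.card_pos
  have hr0 : (0 : ℝ) < r := by exact_mod_cast hr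
  have hM0 : ∀ i j, 0 ≤ M i j := fun i j => by rcases hM i j with h | h <;> simp [h]
  set L : Finset ι := {i | 2 * r * ∑ j, M i j ≤ n} with hL
  obtain ⟨R, hR, f, hfs, hspan⟩ : ∃ R ≤ r, ∃ f : Fin R → κ → ℝ,
      (∀ k, f k ∈ M.row '' (L : Set ι)) ∧
      Submodule.span ℝ (Set.range f) = Submodule.span ℝ (M.row '' (L : Set ι)) := by
    obtain ⟨f, hfs, hspan, -⟩ :=
      Submodule.exists_fun_fin_finrank_span_eq ℝ (M.row '' (L : Set ι))
    refine ⟨_, le_trans ?_ hrank, f, hfs, hspan⟩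
    rw [M.rank_eq_finrank_span_row]
    exact Submodule.finrank_mono (Submodule.span_mono (Set.image_subset_range _ _))
  -- Light rows lie in the span of at most r light rows, so they all vanish where these do. Each has
  -- at most n/(2r) ones, so at most n/2 columns are lost.
  set Y : Finset κ := {j | ∀ k, f k j = 0} with hY
  refine ⟨L, Y, ?_, ?_, ?_⟩
  · intro i hi j hj
    have h1 : M.row i ∈ Submodule.span ℝ (Set.range f) := by
      rw [hspan]
      exact Submodule.subset_span ⟨i, hi, rfl⟩
    have h2 : Submodule.span ℝ (Set.range f) ≤
        LinearMap.ker (LinearMap.proj j : (κ → ℝ) →ₗ[ℝ] ℝ) := by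
      rw [Submodule.span_le]
      rintro _ ⟨k, rfl⟩
      exact (mem_filter.mp hj).2 k
    exact h2 h1
  · have h1 : n * (#Lᶜ : ℝ) ≤ ∑ i ∈ Lᶜ, 2 * r * ∑ j, M i j := by
      rw [mul_comm, ← nsmul_eq_mul, ← sum_const]
      refine sum_le_sum fun i hi => ?_
      simp only [hL, mem_compl, mem_filter, mem_univ, true_and, not_le] at hi
      exact hi.le
    have h2 : ∑ i ∈ Lᶜ, 2 * r * ∑ j, M i j ≤ 2 * r * ∑ i, ∑ j, M i j := by
      rw [mul_sum]
      exact sum_le_sum_of_subset_of_nonneg (subset_univ _) fun i _ _ =>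
        mul_nonneg (by positivity) (sum_nonneg fun j _ => hM0 i j)
    have h3 : n * (2 * #Lᶜ) ≤ n * m := by linarith
    have h4 := le_of_mul_le_mul_left h3 hn
    have h5 : (#L : ℝ) + #Lᶜ = m := by rw [hmdef]; exact_mod_cast card_add_card_compl L
    linarith
  · have hsub : Yᶜ ⊆ univ.biUnion fun k => ({j | f k j ≠ 0} : Finset κ) := by
      intro j hj
      simpa [hY] using hj
    have h1 : (#Yᶜ : ℝ) ≤ ∑ k, (#{j | f k j ≠ 0} : ℝ) := by
      exact_mod_cast (card_le_card hsub).trans card_biUnion_le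
    have h2 : ∀ k, 2 * r * (#{j | f k j ≠ 0} : ℝ) ≤ n := by
      intro k
      obtain ⟨i, hi, hik⟩ := hfs k
      refine le_of_eq_of_le ?_ (mem_filter.mp hi).2
      congr 1
      rw [card_filter, Nat.cast_sum]
      refine sum_congr rfl fun j _ => ?_
      rw [← hik, Matrix.row]
      rcases hM i j with h | h <;> simp [h]
    have h3 : 2 * r * ∑ k, (#{j | f k j ≠ 0} : ℝ) ≤ R * n := by
      rw [mul_sum]
      refine (sum_le_sum fun k _ => h2 k).trans ?_
      simp
    have h4 : r * (2 * (#Yᶜ : ℝ)) ≤ r * n := by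
      have h6 : (R : ℝ) * n ≤ r * n := by gcongr
      have h7 : 2 * r * (#Yᶜ : ℝ) ≤ 2 * r * ∑ k, (#{j | f k j ≠ 0} : ℝ) := by gcongr
      linarith
    have h5 := le_of_mul_le_mul_left h4 hr0
    have h6 : (#Y : ℝ) + #Yᶜ = n := by rw [hndef]; exact_mod_cast card_add_card_compl Y
    linarith

/-- With a = √(rp), b = √(rq) the hypothesis reads a/200000 ≤ l(a² - b²) ≤ 2al(a - b). Thus 1 ≤ l ·
400000(a - b) ≤ l · exp(400000(a - b)); the exponent is twice the inverse of the decrement constant.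
-/
theorem exp_neg_sqrt_le_mul_exp_neg_sqrt {l p q r : ℝ} (hl : 0 < l) (hr : 0 < r) (hp : 0 < p)
    (hq : 0 ≤ q) (h : 1 / 200000 * √(p / r) ≤ l * (p - q)) :
    Real.exp (-(400000 * √(r * p))) ≤ l * Real.exp (-(400000 * √(r * q))) := by
  set a := √(r * p) with ha
  set b := √(r * q) with hb
  have ha0 : 0 < a := Real.sqrt_pos.mpr (by positivity)
  have hb0 : 0 ≤ b := Real.sqrt_nonneg _
  have ha2 : a ^ 2 = r * p := Real.sq_sqrt (by positivity)
  have hb2 : b ^ 2 = r * q := Real.sq_sqrt (by positivity)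
  have hpr : √(p / r) = a / r := by
    rw [eq_div_iff hr.ne', ha, show r * p = r ^ 2 * (p / r) by field_simp,
      Real.sqrt_mul (by positivity), Real.sqrt_sq hr.le, mul_comm]
  have h1 : 1 / 200000 * a ≤ l * (a ^ 2 - b ^ 2) := by
    rw [hpr] at h
    rw [ha2, hb2]
    have h2 := mul_le_mul_of_nonneg_left h hr.le
    have e : r * (1 / 200000 * (a / r)) = 1 / 200000 * a := by field_simp
    linarith
  have hab : b < a := by
    have : 0 < l * (a ^ 2 - b ^ 2) := lt_of_lt_of_le (by positivity) h1
    have := pos_of_mul_pos_right this hl.le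
    exact lt_of_pow_lt_pow_left₀ 2 ha0.le (by linarith)
  have h2 : 1 ≤ l * (400000 * (a - b)) := by
    have h3 : l * (a ^ 2 - b ^ 2) ≤ l * ((a - b) * (2 * a)) := by
      gcongr
      nlinarith
    have h4 : a * 1 ≤ a * (l * (400000 * (a - b))) := by linarith
    exact le_of_mul_le_mul_left h4 ha0
  have h3 : 1 ≤ l * Real.exp (400000 * (a - b)) :=
    h2.trans (mul_le_mul_of_nonneg_left (by linarith [Real.add_one_le_exp (400000 * (a - b))])
      hl.le)
  have e : l * Real.exp (-(400000 * b)) =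
      (l * Real.exp (400000 * (a - b))) * Real.exp (-(400000 * a)) := by
    rw [mul_assoc, ← Real.exp_add]
    ring_nf
  rw [e]
  exact le_mul_of_one_le_left (Real.exp_pos _).le h3

/-- One decrement step for one side: the side ratio x/m is at least the area ratio xy/(mn). -/
theorem mul_exp_neg_sqrt_le {m n x y p q r : ℝ} (hm : 0 < m) (hn : 0 < n) (hx : 0 < x)
    (hy : 0 < y) (hyn : y ≤ n) (hr : 0 < r) (hp : 0 < p) (hq : 0 ≤ q)
    (h : 1 / 200000 * (m * n) * √(p / r) ≤ x * y * (p - q)) :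
    m * Real.exp (-(400000 * √(r * p))) ≤ x * Real.exp (-(400000 * √(r * q))) := by
  have hstep := exp_neg_sqrt_le_mul_exp_neg_sqrt (l := x * y / (m * n)) (by positivity) hr hp hq
    (by
      rw [div_mul_eq_mul_div (_ * _), le_div_iff₀ (by positivity)]
      linarith)
  calc m * Real.exp (-(400000 * √(r * p)))
      ≤ m * (x * y / (m * n) * Real.exp (-(400000 * √(r * q)))) := by gcongr
    _ = x * (y / n) * Real.exp (-(400000 * √(r * q))) := by field_simp
    _ ≤ x * 1 * Real.exp (-(400000 * √(r * q))) := by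
        gcongr
        exact div_le_one_of_le₀ hyn hn.le
    _ = _ := by rw [mul_one]

/-- A binary matrix of rank at most `r` and density `p ≤ 1 / 2` has a zero rectangle whose sides are
an `exp (-O(√(r p)))` fraction of the sides of the matrix. -/
theorem exists_zero_rectangle {r : ℕ} (hr : 1 ≤ r) (k : ℕ) :
    ∀ {ι κ : Type} [Fintype ι] [Fintype κ] [Nonempty ι] [Nonempty κ] (M : Matrix ι κ ℝ) (p : ℝ),
      Fintype.card ι + Fintype.card κ = k → (∀ i j, M i j = 0 ∨ M i j = 1) → M.rank ≤ r →
      ∑ i, ∑ j, M i j = p * (Fintype.card ι * Fintype.card κ) → p ≤ 1 / 2 →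
      ∃ (X : Finset ι) (Y : Finset κ), (∀ i ∈ X, ∀ j ∈ Y, M i j = 0) ∧
        Fintype.card ι * Real.exp (-(400000 * √(r * p))) ≤ 2 * #X ∧
        Fintype.card κ * Real.exp (-(400000 * √(r * p))) ≤ 2 * #Y := by
  induction k using Nat.strong_induction_on with
  | _ k ih =>
  intro ι κ _ _ _ _ M p hk hM hrank hp hp2
  classical
  set m := (Fintype.card ι : ℝ) with hmdef
  set n := (Fintype.card κ : ℝ) with hndef
  have hm : 0 < m := Nat.cast_pos.mpr Fintype.card_pos
  have hn : 0 < n := Nat.cast_pos.mpr Fintype.card_pos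
  have hr0 : (0 : ℝ) < r := by exact_mod_cast hr
  have hM0 : ∀ i j, 0 ≤ M i j := fun i j => by rcases hM i j with h | h <;> simp [h]
  by_cases hp1 : 1 / (4 * r) ≤ p
  · have hp0 : 0 < p := lt_of_lt_of_le (by positivity) hp1
    obtain ⟨X, Y, hXY⟩ := exists_sparse_rectangle hM hr hrank hp hp1 hp2
    have hpos : 0 < ∑ i ∈ X, ∑ j ∈ Y, (p - M i j) :=
      lt_of_lt_of_le (by have : 0 < √(p / r) := Real.sqrt_pos.mpr (by positivity)
                         positivity) hXY
    have hXne : X.Nonempty := by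
      by_contra h
      simp [not_nonempty_iff_eq_empty.mp h] at hpos
    have hYne : Y.Nonempty := by
      by_contra h
      simp [not_nonempty_iff_eq_empty.mp h] at hpos
    -- The whole matrix has zero deficit, so the rectangle is proper and the induction on the sum of
    -- the sides applies.
    have hcard : #X + #Y < k := by
      by_contra! h
      have hX := card_le_univ X
      have hY := card_le_univ Y
      have eX : X = univ := (card_eq_iff_eq_univ X).mp (by omega)
      have eY : Y = univ := (card_eq_iff_eq_univ Y).mp (by omega)
      rw [eX, eY] at hpos
      simp only [sum_sub_distrib, hp, sum_const, card_univ, nsmul_eq_mul, ← hmdef, ← hndef] at hpos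
      linarith [show m * (n * p) = p * (m * n) by ring]
    have hx : (0 : ℝ) < #X := by exact_mod_cast hXne.card_pos
    have hy : (0 : ℝ) < #Y := by exact_mod_cast hYne.card_pos
    have hxm : (#X : ℝ) ≤ m := by rw [hmdef]; exact_mod_cast card_le_univ X
    have hyn : (#Y : ℝ) ≤ n := by rw [hndef]; exact_mod_cast card_le_univ Y
    set q : ℝ := (∑ i ∈ X, ∑ j ∈ Y, M i j) / (#X * #Y) with hq
    have hq0 : 0 ≤ q := div_nonneg (sum_nonneg fun i _ => sum_nonneg fun j _ => hM0 i j)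
      (by positivity)
    have hqsum : ∑ i ∈ X, ∑ j ∈ Y, M i j = q * (#X * #Y) := by
      rw [hq, div_mul_cancel₀ _ (by positivity)]
    have hdiff : ∑ i ∈ X, ∑ j ∈ Y, (p - M i j) = (#X * #Y) * (p - q) := by
      simp only [sum_sub_distrib, hqsum, sum_const, nsmul_eq_mul]
      ring
    have hqp : q < p := by
      rw [hdiff] at hpos
      linarith [pos_of_mul_pos_right hpos (mul_pos hx hy).le]
    have : Nonempty X := hXne.to_subtype
    have : Nonempty Y := hYne.to_subtype
    obtain ⟨X', Y', hzero, hX', hY'⟩ := ih (#X + #Y) hcard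
      (M.submatrix (Subtype.val : X → ι) (Subtype.val : Y → κ)) q (by simp)
      (fun i j => hM _ _) ((Matrix.rank_submatrix_le M _ _).trans hrank)
      (by
        simp only [Matrix.submatrix_apply, Fintype.card_coe]
        rw [← hqsum, ← sum_coe_sort X]
        exact sum_congr rfl fun i _ => sum_coe_sort Y fun j => M i j) (hqp.le.trans hp2)
    refine ⟨X'.map (Function.Embedding.subtype _), Y'.map (Function.Embedding.subtype _),
      ?_, ?_, ?_⟩
    · intro i hi j hj
      obtain ⟨i', hi', rfl⟩ := mem_map.mp hi
      obtain ⟨j', hj', rfl⟩ := mem_map.mp hj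
      exact hzero i' hi' j' hj'
    · rw [card_map]
      refine le_trans ?_ hX'
      rw [Fintype.card_coe]
      exact mul_exp_neg_sqrt_le hm hn hx hy hyn hr0 hp0 hq0 (hdiff ▸ hXY)
    · rw [card_map]
      refine le_trans ?_ hY'
      rw [Fintype.card_coe]
      refine mul_exp_neg_sqrt_le hn hm hy hx hxm hr0 hp0 hq0 ?_
      rw [mul_comm n m, mul_comm (#Y : ℝ), ← hdiff]
      exact hXY
  · obtain ⟨X, Y, hzero, hX, hY⟩ := exists_zero_rectangle_of_sparse hM hr hrank (by
      rw [not_le, lt_div_iff₀ (by positivity)] at hp1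
      rw [hp]
      have : p * (4 * r) * (m * n) ≤ 1 * (m * n) := by gcongr
      linarith)
    have hexp : Real.exp (-(400000 * √(r * p))) ≤ 1 := by
      rw [Real.exp_le_one_iff]
      linarith [Real.sqrt_nonneg (r * p)]
    exact ⟨X, Y, hzero, (mul_le_of_le_one_right hm.le hexp).trans hX,
      (mul_le_of_le_one_right hn.le hexp).trans hY⟩

end ZeroRectangle

/-! ### From zero rectangles to the bound on `maxZeroSize` -/

theorem eq_zero_of_rank_eq_zero {ι κ : Type*} [Fintype ι] [Fintype κ] {M : Matrix ι κ ℝ}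
    (h : M.rank = 0) : M = 0 := by
  rw [M.rank_eq_finrank_span_row, Submodule.finrank_eq_zero, Submodule.span_eq_bot] at h
  ext i j
  exact congrFun (h _ ⟨i, rfl⟩) j

theorem numOnes_eq_sum {m n : ℕ} {M : Matrix (Fin m) (Fin n) ℝ} (hM : IsBinary M) :
    (numOnes M : ℝ) = ∑ i, ∑ j, M i j := by
  classical
  rw [numOnes, card_filter, Nat.cast_sum, Fintype.sum_prod_type]
  refine sum_congr rfl fun i _ => sum_congr rfl fun j _ => ?_
  rcases hM i j with h | h <;> simp [h]

theorem le_maxZeroSize {n : ℕ} {M : Matrix (Fin n) (Fin n) ℝ} {X Y : Finset (Fin n)}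
    (h : ∀ i ∈ X, ∀ j ∈ Y, M i j = 0) : min #X #Y ≤ maxZeroSize M := by
  obtain ⟨X', hX', hcX⟩ := exists_subset_card_eq (min_le_left #X #Y)
  obtain ⟨Y', hY', hcY⟩ := exists_subset_card_eq (min_le_right #X #Y)
  exact (isGreatest_maxZeroSize M).2
    ⟨X', Y', hcX, hcY, fun i hi j hj => h i (hX' hi) j (hY' hj)⟩

/-- For s ≥ 1 the factor 2 is absorbed into exp s, and log 2 > 1/2 allows doubling 400001 in the
change of base. -/
theorem two_mul_exp_le_two_rpow {s : ℝ} (hs : 1 ≤ s) :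
    2 * Real.exp (400000 * s) ≤ (2 : ℝ) ^ (800002 * s) := by
  have h2 : (2 : ℝ) ≤ Real.exp s := by linarith [Real.add_one_le_exp s]
  calc 2 * Real.exp (400000 * s) ≤ Real.exp s * Real.exp (400000 * s) := by gcongr
    _ = Real.exp (400001 * s) := by rw [← Real.exp_add]; ring_nf
    _ ≤ Real.exp (Real.log 2 * (800002 * s)) := by
        rw [Real.exp_le_exp]
        nlinarith [Real.log_two_gt_d9]
    _ = (2 : ℝ) ^ (800002 * s) := (Real.rpow_def_of_pos two_pos _).symm

end LowRank

open Finset LowRank in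
theorem mainTheorem3 :
    ∃ c : ℝ, 0 < c ∧ ∀ (n r : ℕ) (M : Matrix (Fin n) (Fin n) ℝ),
      LowRank.IsBinary M → M.rank ≤ r → LowRank.density M ≤ 1 / 2 →
        (n : ℝ) / (2 : ℝ) ^ (c * Real.sqrt (r : ℝ)) ≤ (LowRank.maxZeroSize M : ℝ) := by
  refine ⟨800002, by norm_num, fun n r M hM hrank hdens => ?_⟩
  rcases Nat.eq_zero_or_pos n with rfl | hn
  · simp
  -- Rank zero is separate, as the decrement needs r ≥ 1; here the bound is n itself, attained by
  -- the zero matrix.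
  rcases Nat.eq_zero_or_pos r with rfl | hr
  · have h0 : M = 0 := eq_zero_of_rank_eq_zero (Nat.le_zero.mp hrank)
    have h := le_maxZeroSize (M := M) (X := univ) (Y := univ) (by simp [h0])
    simpa using h
  have hn0 : (0 : ℝ) < n := by exact_mod_cast hn
  have hr1 : (1 : ℝ) ≤ r := by exact_mod_cast hr
  have : Nonempty (Fin n) := ⟨⟨0, hn⟩⟩
  obtain ⟨X, Y, hzero, hX, hY⟩ := exists_zero_rectangle hr _ M (density M) rfl hM hrank
    (by
      rw [← numOnes_eq_sum hM, density, Fintype.card_fin, div_mul_cancel₀ _ (by positivity)])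
    hdens
  rw [Fintype.card_fin] at hX hY
  have hz : n * Real.exp (-(400000 * √(r * density M))) ≤ 2 * (min #X #Y : ℕ) := by
    rcases min_choice #X #Y with h | h <;> rw [h] <;> assumption
  have hz2 : ((min #X #Y : ℕ) : ℝ) ≤ maxZeroSize M := by exact_mod_cast le_maxZeroSize hzero
  have hs : (1 : ℝ) ≤ √r := Real.one_le_sqrt.mpr hr1
  have hexp : Real.exp (-(400000 * √r)) ≤ Real.exp (-(400000 * √(r * density M))) := by
    have : √(r * density M) ≤ √r := Real.sqrt_le_sqrt (by nlinarith)
    rw [Real.exp_le_exp]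
    linarith
  have hpow := two_mul_exp_le_two_rpow hs
  rw [div_le_iff₀ (by positivity)]
  have h1 : n * Real.exp (-(400000 * √r)) ≤ 2 * maxZeroSize M := by
    have : n * Real.exp (-(400000 * √r)) ≤ n * Real.exp (-(400000 * √(r * density M))) := by gcongr
    linarith
  have h2 : Real.exp (-(400000 * √r)) * Real.exp (400000 * √r) = 1 := by
    rw [← Real.exp_add]; simp
  calc (n : ℝ) = n * Real.exp (-(400000 * √r)) * Real.exp (400000 * √r) := by
        rw [mul_assoc, h2, mul_one]
    _ ≤ 2 * maxZeroSize M * Real.exp (400000 * √r) := by gcongr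
    _ = maxZeroSize M * (2 * Real.exp (400000 * √r)) := by ring
    _ ≤ maxZeroSize M * (2 : ℝ) ^ (800002 * √r) := by gcongr
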